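/- Let $1\le m\le n$ and $R>0$. Consider the zero-forcing V-BLAST with $m$ transmit and $n$ receive antennas over an i.i.d. Rayleigh fading channel: the channel matrix $\mathbf H=[\mathbf h_1,\dots,\mathbf h_m]\in\mathbb C^{n\times m}$ has independent $\mathcal{CN}(0,1)$ entries. Streams are detected in the order $1,2,\dots,m$, with successive interference cancellation and without ordering; the $i$-th stream has gain $g_i=\|\mathbf h_{i\perp}\|^2$, where $\mathbf h_{i\perp}$ is the projection of $\mathbf h_i$ onto the orthogonal complement of $\mathrm{span}(\mathbf h_{i+1},\dots,\mathbf h_m)$. For the average SNR $\gamma_0>0$ and a power allocation $\boldsymbol\alpha=(\alpha_1,\dots,\alpha_m)$ with $\alpha_i\ge 0$ and $\sum_{i=1}^m\alpha_i=m$, which does not depend on the realization of $\mathbf H$, the $i$-th stream has the instantaneous capacity $C_i=\ln(1+\alpha_i g_i\gamma_0)$, and the outage probability at the fixed per-stream rate $R$ is $$P_{out}(\boldsymbol\alpha)=\Pr\{C_i<R\text{ for some }i\}.$$ Then for every $\gamma_0>0$ there is an allocation that minimizes $P_{out}$, and there are coefficients $b_1,\dots,b_m>0$ that depend only on $n$,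 $m$, $R$ (not on $\gamma_0$) such that, for any choice of an optimum allocation $\overline{\boldsymbol\alpha}(\gamma_0)\in\arg\min P_{out}$ for each $\gamma_0>0$, as $\gamma_0\to\infty$, $$\overline\alpha_i(\gamma_0)\sim\frac{b_i}{(4\gamma_0)^{\frac{i-1}{n-m+i+1}}},\quad i=2,\dots,m,$$ $$\overline\alpha_1(\gamma_0)=m-\sum_{i=2}^m\overline\alpha_i(\gamma_0),\qquad m-\overline\alpha_1(\gamma_0)\sim\sum_{i=2}^m\frac{b_i}{(4\gamma_0)^{\frac{i-1}{n-m+i+1}}},$$ where $f\sim g$ means $f=g\,(1+o(1))$. In particular $\overline\alpha_1(\gamma_0)\to m$, i.e. almost all the power goes to the first stream. -/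

import Mathlib

open MeasureTheory ProbabilityTheory Filter Topology Asymptotics
open scoped NNReal

namespace VBLAST

/-- The circularly symmetric complex Gaussian law `CN(0, 1)`: the real and imaginary parts are
independent, centred Gaussians of variance `1/2`, so that the mean power is `1`
(the modulus is Rayleigh distributed). -/
noncomputable def complexGaussian : Measure ℂ :=
  ((gaussianReal 0 (1 / 2)).prod (gaussianReal 0 (1 / 2))).map
    Complex.measurableEquivRealProd.symm

/-- An i.i.d. Rayleigh fading channel with `n` receive and `m` transmit antennas: the entries of
the random `n × m` matrix `H` are independent `CN(0, 1)` random variables. -/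
structure IsIIDRayleigh {Ω : Type*} [MeasurableSpace Ω] {n m : ℕ}
    (H : Ω → Matrix (Fin n) (Fin m) ℂ) (μ : Measure Ω) : Prop where
  law : ∀ r i, HasLaw (fun ω => H ω r i) complexGaussian μ
  indep : iIndepFun (fun (p : Fin n × Fin m) (ω : Ω) => H ω p.1 p.2) μ

/-- The column of the channel matrix that belongs to transmitter `i`, as a vector of the
Hermitian space `ℂⁿ`. -/
noncomputable def column {n m : ℕ} (H : Matrix (Fin n) (Fin m) ℂ) (i : Fin m) :
    EuclideanSpace ℂ (Fin n) :=
  WithLp.toLp 2 (fun r => H r i)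

/-- The subspace spanned by the columns of the streams that are detected after stream `i`. -/
noncomputable def interferenceSpace {n m : ℕ} (H : Matrix (Fin n) (Fin m) ℂ) (i : Fin m) :
    Submodule ℂ (EuclideanSpace ℂ (Fin n)) :=
  Submodule.span ℂ (column H '' {j | i < j})

/-- The power gain `g_i = ‖h_{i⊥}‖²` of stream `i` under zero forcing with successive interference
cancellation: `h_{i⊥}` is column `i` projected onto the orthogonal complement of the columns of the
yet-to-be-detected streams. -/
noncomputable def streamGain {n m : ℕ} (H : Matrix (Fin n) (Fin m) ℂ) (i : Fin m) : ℝ :=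
  ‖(interferenceSpace H i)ᗮ.starProjection (column H i)‖ ^ 2

/-- The instantaneous capacity `C_i = ln (1 + α_i g_i γ₀)` of stream `i` (in nats). -/
noncomputable def streamCapacity {n m : ℕ} (γ₀ : ℝ) (α : Fin m → ℝ)
    (H : Matrix (Fin n) (Fin m) ℂ) (i : Fin m) : ℝ :=
  Real.log (1 + α i * streamGain H i * γ₀)

/-- The outage probability for the fixed per-stream rate `R`: the system is in outage when at least
one stream is, that is, when `C_i < R` for some `i`. -/
noncomputable def outageProb {Ω : Type*} [MeasurableSpace Ω] {n m : ℕ} (μ : Measure Ω)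
    (H : Ω → Matrix (Fin n) (Fin m) ℂ) (R γ₀ : ℝ) (α : Fin m → ℝ) : ℝ :=
  μ.real {ω | ∃ i, streamCapacity γ₀ α (H ω) i < R}

/-- The power allocations: non-negative, with total power `m`. -/
def allocations (m : ℕ) : Set (Fin m → ℝ) :=
  {α | (∀ i, 0 ≤ α i) ∧ ∑ i, α i = m}

/-- `α` is an optimum allocation of the average power at average SNR `γ₀`: among all allocations
(which do not depend on the channel realization) it minimizes the outage probability. -/
def IsOptimalAllocation {Ω : Type*} [MeasurableSpace Ω] {n m : ℕ} (μ : Measure Ω)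
    (H : Ω → Matrix (Fin n) (Fin m) ℂ) (R γ₀ : ℝ) (α : Fin m → ℝ) : Prop :=
  α ∈ allocations m ∧ IsMinOn (outageProb μ H R γ₀) (allocations m) α

/-- The high-SNR expression `b_k / (4 γ₀) ^ ((k - 1) / (n - m + k + 1))` for the power of stream
`k`. Streams are numbered from `0` here, so `k = i + 1`. -/
noncomputable def approxPower (n : ℕ) {m : ℕ} (b : Fin m → ℝ) (i : Fin m) (γ₀ : ℝ) : ℝ :=
  b i / (4 * γ₀) ^ (((i : ℕ) : ℝ) / ((n : ℝ) - (m : ℝ) + ((i : ℕ) : ℝ) + 2))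

end VBLAST

/-!
The gains are independent, and the gain of stream `i` (counted from `0`) has the Gamma law of integer
shape `k_i = n - m + i + 1`: given the later columns, which are almost surely linearly independent,
it is the squared norm of a standard complex Gaussian vector projected onto a subspace of dimension
`k_i`. With `c = e ^ R - 1` and the Gamma survival function `S_k(x) = e ^ (-x) ∑_{j < k} x ^ j / j!`,
the outage probability is therefore `1 - ∏ S_{k_i}(c / (γ₀ α_i))` (`outageProb_eq`), where a stream
without power contributes the factor `0`.

The product is continuous on the compact set of allocations, so an optimum exists, and at an optimum
all powers are positive. Shifting power between two streams gives the first-order condition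
(`stationary_of_isMaxOn`): with `x_i = c / (γ₀ α_i)` and `T_k = ∑_{j < k} x ^ j / j!`, the quantity
`x_i ^ (k_i + 1) / ((k_i - 1)! T_{k_i}(x_i))` does not depend on `i`. Some stream has power at least
`1`, so the common value tends to `0`, hence so do all `x_i` (`tendsto_threshold_zero`), and
`x_i ^ (k_i + 1) / (k_i - 1)! ~ x_0 ^ (k_0 + 1) / (k_0 - 1)!` (`isEquivalent_threshold`). As `k_0` is
the least shape, `α_i / α_0 = x_0 / x_i → 0` for `i ≠ 0`; thus `α_0 → m`, `x_0 ~ c / (m γ₀)`, and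
`α_i = c / (γ₀ x_i)` has the claimed power law (`isEquivalent_power`).
-/

namespace VBLAST
open scoped ENNReal

/-! ### The Gamma survival function -/

/-- The partial sum `∑_{j < k} x ^ j / j!` of the exponential series. -/
noncomputable def expPartialSum (k : ℕ) (x : ℝ) : ℝ :=
  ∑ j ∈ Finset.range k, x ^ j / (j.factorial : ℝ)

/-- The survival function `P(X ≥ x)`, `x ≥ 0`, of the Gamma (Erlang) law with integer shape `k`
and rate `1`. -/
noncomputable def gammaTail (k : ℕ) (x : ℝ) : ℝ :=
  Real.exp (-x) * expPartialSum k x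

theorem continuous_expPartialSum (k : ℕ) : Continuous (expPartialSum k) := by
  unfold expPartialSum
  fun_prop

theorem continuous_gammaTail (k : ℕ) : Continuous (gammaTail k) := by
  have := continuous_expPartialSum k
  unfold gammaTail
  fun_prop

theorem expPartialSum_zero {k : ℕ} (hk : 0 < k) : expPartialSum k 0 = 1 := by
  obtain ⟨k, rfl⟩ := Nat.exists_eq_succ_of_ne_zero hk.ne'
  simp [expPartialSum, Finset.sum_range_succ']

theorem gammaTail_zero {k : ℕ} (hk : 0 < k) : gammaTail k 0 = 1 := by
  simp [gammaTail, expPartialSum_zero hk]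

theorem one_le_expPartialSum {k : ℕ} (hk : 0 < k) {x : ℝ} (hx : 0 ≤ x) :
    1 ≤ expPartialSum k x := by
  obtain ⟨k, rfl⟩ := Nat.exists_eq_succ_of_ne_zero hk.ne'
  simp only [expPartialSum, Finset.sum_range_succ', Nat.succ_eq_add_one]
  simp only [pow_zero, Nat.factorial_zero, Nat.cast_one, div_one, le_add_iff_nonneg_left]
  positivity

theorem gammaTail_pos {k : ℕ} (hk : 0 < k) {x : ℝ} (hx : 0 ≤ x) : 0 < gammaTail k x :=
  mul_pos (Real.exp_pos _) (zero_lt_one.trans_le (one_le_expPartialSum hk hx))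

theorem hasDerivAt_expPartialSum_succ (k : ℕ) (x : ℝ) :
    HasDerivAt (expPartialSum (k + 1)) (expPartialSum k x) x := by
  induction k with
  | zero =>
    have : expPartialSum (0 + 1) = fun _ => 1 := by ext y; simp [expPartialSum]
    rw [this]
    simpa [expPartialSum] using hasDerivAt_const x (1 : ℝ)
  | succ k ih =>
    have h1 : expPartialSum (k + 1 + 1)
        = fun y => expPartialSum (k + 1) y + y ^ (k + 1) / ((k + 1).factorial : ℝ) := by
      ext y; simp [expPartialSum, Finset.sum_range_succ _ (k + 1)]
    have h2 : expPartialSum (k + 1) x = expPartialSum k x + x ^ k / (k.factorial : ℝ) := by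
      simp [expPartialSum, Finset.sum_range_succ _ k]
    rw [h1, h2]
    refine ih.add (((hasDerivAt_pow (k + 1) x).div_const _).congr_deriv ?_)
    rw [Nat.factorial_succ]
    have := Nat.factorial_ne_zero k
    push_cast
    field_simp

/-- Minus the derivative of the survival function is the Gamma density: the sum telescopes. -/
theorem hasDerivAt_gammaTail (k : ℕ) (x : ℝ) :
    HasDerivAt (gammaTail (k + 1)) (-(Real.exp (-x) * (x ^ k / (k.factorial : ℝ)))) x := by
  have h2 : expPartialSum (k + 1) x = expPartialSum k x + x ^ k / (k.factorial : ℝ) := by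
    simp [expPartialSum, Finset.sum_range_succ _ k]
  refine (((hasDerivAt_neg x).exp).mul (hasDerivAt_expPartialSum_succ k x)).congr_deriv ?_
  rw [h2]
  ring

theorem tendsto_gammaTail_atTop (k : ℕ) : Tendsto (gammaTail k) atTop (𝓝 0) := by
  have h : gammaTail k
      = fun x => ∑ j ∈ Finset.range k, x ^ j * Real.exp (-x) / (j.factorial : ℝ) := by
    ext x
    simp only [gammaTail, expPartialSum, Finset.mul_sum]
    exact Finset.sum_congr rfl fun j _ => by ring
  rw [h]
  rw [show (0 : ℝ) = ∑ j ∈ Finset.range k, 0 / (j.factorial : ℝ) by simp]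
  exact tendsto_finsetSum _ fun j _ =>
    (Real.tendsto_pow_mul_exp_neg_atTop_nhds_zero j).div_const _

/-- The probability that a stream of diversity order `k` that is given the power `a` is not in
outage, as a function of `a`; here `s = (e ^ R - 1) / γ₀`. -/
noncomputable def reliability (k : ℕ) (s a : ℝ) : ℝ :=
  if 0 < a then gammaTail k (s / a) else 0

theorem reliability_of_pos (k : ℕ) (s : ℝ) {a : ℝ} (ha : 0 < a) :
    reliability k s a = gammaTail k (s / a) := if_pos ha

theorem reliability_of_nonpos (k : ℕ) (s : ℝ) {a : ℝ} (ha : a ≤ 0) :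
    reliability k s a = 0 := if_neg ha.not_gt

theorem reliability_pos {k : ℕ} (hk : 0 < k) {s : ℝ} (hs : 0 < s) {a : ℝ} (ha : 0 < a) :
    0 < reliability k s a := by
  rw [reliability_of_pos k s ha]
  exact gammaTail_pos hk (by positivity)

/-- At `a = 0` this is the decay of the survival function at infinity. -/
theorem continuous_reliability (k : ℕ) {s : ℝ} (hs : 0 < s) : Continuous (reliability k s) := by
  rw [continuous_iff_continuousAt]
  intro a
  rcases lt_trichotomy a 0 with ha | rfl | ha
  · refine (continuousAt_const (y := (0 : ℝ))).congr ?_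
    filter_upwards [Iio_mem_nhds ha] with y hy
    exact (reliability_of_nonpos k s (le_of_lt hy)).symm
  · rw [continuousAt_iff_continuous_left'_right']
    rw [ContinuousWithinAt, ContinuousWithinAt, reliability_of_nonpos k s le_rfl]
    constructor
    · refine tendsto_const_nhds.congr' ?_
      filter_upwards [self_mem_nhdsWithin] with y hy
      exact (reliability_of_nonpos k s (le_of_lt hy)).symm
    · have h : Tendsto (fun y : ℝ => gammaTail k (s * y⁻¹)) (𝓝[>] 0) (𝓝 0) :=
        (tendsto_gammaTail_atTop k).comp (tendsto_inv_nhdsGT_zero.const_mul_atTop hs)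
      refine h.congr' ?_
      filter_upwards [self_mem_nhdsWithin] with y hy
      rw [reliability_of_pos k s hy, div_eq_mul_inv]
  · have h : ContinuousAt (fun y => gammaTail k (s / y)) a :=
      (continuous_gammaTail k).continuousAt.comp (by fun_prop (disch := exact ha.ne'))
    refine h.congr ?_
    filter_upwards [Ioi_mem_nhds ha] with y hy
    exact (reliability_of_pos k s hy).symm

theorem hasDerivAt_reliability (k : ℕ) (s : ℝ) {a : ℝ} (ha : 0 < a) :
    HasDerivAt (reliability (k + 1) s)
      (Real.exp (-(s / a)) * ((s / a) ^ k / (k.factorial : ℝ)) * (s / a ^ 2)) a := by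
  have h : HasDerivAt (fun y => gammaTail (k + 1) (s / y))
      (-(Real.exp (-(s / a)) * ((s / a) ^ k / (k.factorial : ℝ))) * (-(s / a ^ 2))) a := by
    refine (hasDerivAt_gammaTail k (s / a)).comp a ?_
    refine ((hasDerivAt_const a s).div (hasDerivAt_id a) ha.ne').congr_deriv ?_
    simp [neg_div]
  refine (h.congr_of_eventuallyEq ?_).congr_deriv (by ring)
  filter_upwards [Ioi_mem_nhds ha] with y hy
  exact reliability_of_pos (k + 1) s hy

/-! ### Standard complex Gaussian vectors and their projections -/

theorem integral_pow_mul_exp_neg_sq_Ioi (k : ℕ) {a : ℝ} (ha : 0 ≤ a) :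
    IntegrableOn (fun y : ℝ => y ^ (2 * k + 1) * Real.exp (-y ^ 2)) (Set.Ioi a) ∧
      ∫ y in Set.Ioi a, y ^ (2 * k + 1) * Real.exp (-y ^ 2)
        = k.factorial / 2 * gammaTail (k + 1) (a ^ 2) := by
  have hd : ∀ y ∈ Set.Ici a, HasDerivAt
      (fun y : ℝ => -((k.factorial : ℝ) / 2 * gammaTail (k + 1) (y ^ 2)))
      (y ^ (2 * k + 1) * Real.exp (-y ^ 2)) y := by
    intro y _
    have h := ((hasDerivAt_gammaTail k (y ^ 2)).comp y (hasDerivAt_pow 2 y)).const_mul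
      ((k.factorial : ℝ) / 2)
    refine h.neg.congr_deriv ?_
    have := Nat.factorial_ne_zero k
    push_cast
    field_simp
    ring
  have hl : Tendsto (fun y : ℝ => -((k.factorial : ℝ) / 2 * gammaTail (k + 1) (y ^ 2)))
      atTop (𝓝 0) := by
    have := (((tendsto_gammaTail_atTop (k + 1)).comp
      (tendsto_pow_atTop (α := ℝ) two_ne_zero)).const_mul ((k.factorial : ℝ) / 2)).neg
    simpa using this
  have hp : ∀ y ∈ Set.Ioi a, 0 ≤ y ^ (2 * k + 1) * Real.exp (-y ^ 2) := fun y hy => by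
    have : 0 ≤ y := ha.trans (le_of_lt hy)
    positivity
  refine ⟨integrableOn_Ioi_deriv_of_nonneg' hd hp hl, ?_⟩
  rw [integral_Ioi_of_hasDerivAt_of_nonneg' hd hp hl]
  simp

/-- In real dimension `2 (k + 1)` the radial tail integral of `exp (-‖v‖ ^ 2)` is proportional to the
Gamma survival function of shape `k + 1`. The constant `K` is the integral over the whole space. -/
theorem lintegral_exp_neg_norm_sq_tail {E : Type*} [NormedAddCommGroup E] [NormedSpace ℝ E]
    [FiniteDimensional ℝ E] [MeasurableSpace E] [BorelSpace E] (μ : Measure E)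
    [μ.IsAddHaarMeasure] (k : ℕ) (hk : Module.finrank ℝ E = 2 * (k + 1)) :
    ∃ K : ℝ≥0∞, ∀ x : ℝ, 0 ≤ x →
      ∫⁻ v in {v : E | x ≤ ‖v‖ ^ 2}, ENNReal.ofReal (Real.exp (-‖v‖ ^ 2)) ∂μ
        = K * ENNReal.ofReal (gammaTail (k + 1) x) := by
  have : Nontrivial E := Module.nontrivial_of_finrank_pos (R := ℝ) (by omega)
  refine ⟨ENNReal.ofReal (Module.finrank ℝ E * μ.real (Metric.ball 0 1) * (k.factorial / 2)),
    fun x hx => ?_⟩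
  set f : ℝ → ℝ := fun y => if x ≤ y ^ 2 then Real.exp (-y ^ 2) else 0 with hf
  have hms : MeasurableSet {v : E | x ≤ ‖v‖ ^ 2} :=
    measurableSet_le measurable_const (by fun_prop)
  have hfun : Set.EqOn (fun y : ℝ => y ^ (Module.finrank ℝ E - 1) • f y)
      ((Set.Ici (√x)).indicator fun y : ℝ => y ^ (2 * k + 1) * Real.exp (-y ^ 2))
      (Set.Ioi 0) := by
    intro y hy
    have hdim : Module.finrank ℝ E - 1 = 2 * k + 1 := by omega
    simp only [hdim, hf, smul_eq_mul, Set.indicator, Set.mem_Ici,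
      Real.sqrt_le_left (le_of_lt (Set.mem_Ioi.mp hy)), mul_ite, mul_zero]
  -- Only the inclusion of the end point `√x` distinguishes the two sets.
  have hset : (Set.Ioi 0 ∩ Set.Ici (√x) : Set ℝ) =ᵐ[volume] Set.Ioi (√x) := by
    have h1 : (Set.Ioi 0 ∩ Set.Ioi (√x) : Set ℝ) = Set.Ioi (√x) := by
      rw [Set.Ioi_inter_Ioi, max_eq_right (Real.sqrt_nonneg x)]
    have h2 : (Set.Ioi 0 ∩ Set.Ici (√x) : Set ℝ) =ᵐ[volume] (Set.Ioi 0 ∩ Set.Ioi (√x) : Set ℝ) :=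
      (ae_eq_refl _).inter Ioi_ae_eq_Ici.symm
    rwa [h1] at h2
  obtain ⟨hint, hval⟩ := integral_pow_mul_exp_neg_sq_Ioi k (Real.sqrt_nonneg x)
  have hI : Integrable (fun v : E => f ‖v‖) μ := by
    rw [integrable_fun_norm_addHaar μ, integrableOn_congr_fun hfun measurableSet_Ioi,
      IntegrableOn, integrable_indicator_iff measurableSet_Ici, IntegrableOn,
      Measure.restrict_restrict measurableSet_Ici, Set.inter_comm, Measure.restrict_congr_set hset]
    exact hint
  have hV : ∫ v, f ‖v‖ ∂μ = Module.finrank ℝ E * μ.real (Metric.ball 0 1) * (k.factorial / 2)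
      * gammaTail (k + 1) x := by
    rw [integral_fun_norm_addHaar μ f, setIntegral_congr_fun measurableSet_Ioi hfun,
      setIntegral_indicator measurableSet_Ici, setIntegral_congr_set hset, hval,
      Real.sq_sqrt hx]
    simp only [nsmul_eq_mul, smul_eq_mul]
    ring
  rw [← lintegral_indicator hms, ← ENNReal.ofReal_mul (by positivity), ← hV,
    ofReal_integral_eq_lintegral_ofReal hI
      (Eventually.of_forall fun v => by simp only [hf]; split_ifs <;> positivity)]
  refine lintegral_congr fun v => ?_
  simp only [Set.indicator, Set.mem_ofPred_eq, hf]
  split_ifs <;> simp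

/-- The measure `γ` on the Hermitian space `E` has the density `exp (-‖v‖ ^ 2)` with respect to
some Haar measure. For a probability measure this says that `γ` is the standard circularly
symmetric Gaussian law of `E`; the normalizing constant is left implicit. -/
def IsStandardGaussian {E : Type*} [NormedAddCommGroup E] [InnerProductSpace ℂ E]
    [FiniteDimensional ℂ E] [MeasurableSpace E] [BorelSpace E] (γ : Measure E) : Prop :=
  ∃ μ : Measure E, μ.IsAddHaarMeasure ∧ ∃ c : ℝ≥0∞,
    γ = c • μ.withDensity fun v => ENNReal.ofReal (Real.exp (-‖v‖ ^ 2))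

/-- The squared norm of the orthogonal projection of a standard Gaussian vector onto a subspace of
dimension `k` has the Gamma law of shape `k`: the density factors along `E ≃ W × Wᗮ`. -/
theorem IsStandardGaussian.measure_le_norm_sq_starProjection {E : Type*} [NormedAddCommGroup E]
    [InnerProductSpace ℂ E] [FiniteDimensional ℂ E] [MeasurableSpace E] [BorelSpace E]
    {γ : Measure E} [IsProbabilityMeasure γ] (hγ : IsStandardGaussian γ) (W : Submodule ℂ E)
    {k : ℕ} (hk : 0 < k) (hW : Module.finrank ℂ W = k) {x : ℝ} (hx : 0 ≤ x) :
    γ {v | x ≤ ‖W.starProjection v‖ ^ 2} = ENNReal.ofReal (gammaTail k x) := by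
  obtain ⟨μ, hμ, c, rfl⟩ := hγ
  obtain ⟨k, rfl⟩ := Nat.exists_eq_succ_of_ne_zero hk.ne'
  let L : (W × Wᗮ) ≃L[ℝ] E :=
    ((Submodule.prodEquivOfIsCompl W Wᗮ W.isCompl_orthogonal).restrictScalars
      ℝ).toContinuousLinearEquiv
  have hL : ∀ p : W × Wᗮ, L p = p.1 + p.2 := fun p => rfl
  have hnorm : ∀ p : W × Wᗮ, ‖L p‖ ^ 2 = ‖p.1‖ ^ 2 + ‖p.2‖ ^ 2 := by
    intro p
    rw [hL, sq, sq, sq, norm_add_sq_eq_norm_sq_add_norm_sq_of_inner_eq_zero _ _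
      (W.inner_right_of_mem_orthogonal p.1.2 p.2.2)]
    rfl
  have hproj : ∀ p : W × Wᗮ, W.starProjection (L p) = p.1 := by
    intro p
    rw [hL, map_add, Submodule.starProjection_eq_self_iff.mpr p.1.2,
      W.starProjection_apply_eq_zero_iff.mpr p.2.2, add_zero]
  have hdim : Module.finrank ℝ W = 2 * (k + 1) := by
    rw [finrank_real_of_complex, hW]
  obtain ⟨K, hK⟩ := lintegral_exp_neg_norm_sq_tail (Measure.addHaar : Measure W) k hdim
  let ρ : Measure (W × Wᗮ) := (Measure.addHaar : Measure W).prod (Measure.addHaar : Measure Wᗮ)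
  have hρ : (ρ.map L).IsAddHaarMeasure := L.isAddHaarMeasure_map ρ
  set d : ℝ≥0 := Measure.addHaarScalarFactor μ (ρ.map L) with hd
  have hμd : μ = d • ρ.map L := Measure.isAddLeftInvariant_eq_smul μ (ρ.map L)
  set J : ℝ≥0∞ := ∫⁻ u : Wᗮ, ENNReal.ofReal (Real.exp (-‖u‖ ^ 2)) ∂Measure.addHaar with hJ
  have key : ∀ x : ℝ, 0 ≤ x →
      (c • μ.withDensity fun v => ENNReal.ofReal (Real.exp (-‖v‖ ^ 2)))
        {v | x ≤ ‖W.starProjection v‖ ^ 2}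
      = c * d * K * J * ENNReal.ofReal (gammaTail (k + 1) x) := by
    intro x hx
    have hmE : MeasurableSet {v : E | x ≤ ‖W.starProjection v‖ ^ 2} :=
      measurableSet_le measurable_const (by fun_prop)
    have hpre : L ⁻¹' {v : E | x ≤ ‖W.starProjection v‖ ^ 2}
        = {w : W | x ≤ ‖w‖ ^ 2} ×ˢ Set.univ := by
      ext p
      simp [hproj]
    rw [Measure.smul_apply, withDensity_apply _ hmE, hμd, Measure.restrict_smul,
      lintegral_smul_measure, setLIntegral_map hmE (by fun_prop) L.continuous.measurable, hpre,
      ← Measure.prod_restrict]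
    have : ∀ p : W × Wᗮ, ENNReal.ofReal (Real.exp (-‖L p‖ ^ 2))
        = ENNReal.ofReal (Real.exp (-‖p.1‖ ^ 2)) * ENNReal.ofReal (Real.exp (-‖p.2‖ ^ 2)) := by
      intro p
      rw [hnorm, ← ENNReal.ofReal_mul (Real.exp_pos _).le, ← Real.exp_add]
      ring_nf
    simp_rw [this]
    rw [lintegral_prod_mul (f := fun w : W => ENNReal.ofReal (Real.exp (-‖w‖ ^ 2)))
      (g := fun u : Wᗮ => ENNReal.ofReal (Real.exp (-‖u‖ ^ 2))) (by fun_prop) (by fun_prop), hK x hx, Measure.restrict_univ, ← hJ,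
      smul_eq_mul, ENNReal.smul_def, smul_eq_mul]
    ring
  -- The constant `c * d * K * J` is `1`, because `γ` is a probability measure.
  have h1 := key 0 le_rfl
  have huniv : {v : E | 0 ≤ ‖W.starProjection v‖ ^ 2} = Set.univ := by
    ext v; simp
  rw [huniv, measure_univ, gammaTail_zero hk, ENNReal.ofReal_one, mul_one] at h1
  rw [key x hx, ← h1, one_mul]

theorem IsStandardGaussian.measure_submodule {E : Type*} [NormedAddCommGroup E]
    [InnerProductSpace ℂ E] [FiniteDimensional ℂ E] [MeasurableSpace E] [BorelSpace E]
    {γ : Measure E} (hγ : IsStandardGaussian γ) (V : Submodule ℂ E) (hV : V ≠ ⊤) :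
    γ V = 0 := by
  obtain ⟨μ, hμ, c, rfl⟩ := hγ
  have h0 : μ V = 0 := by
    have := Measure.addHaar_submodule μ (V.restrictScalars ℝ) (by simpa using hV)
    simpa using this
  rw [Measure.smul_apply, withDensity_absolutelyContinuous _ _ h0, smul_zero]

theorem complexGaussian_eq_withDensity :
    complexGaussian
      = volume.withDensity fun z : ℂ => ENNReal.ofReal (Real.pi⁻¹ * Real.exp (-‖z‖ ^ 2)) := by
  have h2 : (1 / 2 : ℝ≥0) ≠ 0 := by norm_num
  have hpi : √(Real.pi) * √(Real.pi) = Real.pi := Real.mul_self_sqrt Real.pi_pos.le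
  ext s hs
  rw [complexGaussian, gaussianReal_of_var_ne_zero _ h2,
    prod_withDensity (by fun_prop) (by fun_prop),
    Measure.map_apply Complex.measurableEquivRealProd.symm.measurable hs,
    withDensity_apply _ (Complex.measurableEquivRealProd.symm.measurable hs),
    withDensity_apply _ hs, ← Measure.volume_eq_prod,
    ← Complex.volume_preserving_equiv_real_prod.symm.setLIntegral_comp_preimage_emb
      Complex.measurableEquivRealProd.symm.measurableEmbedding]
  refine lintegral_congr fun p => ?_
  rw [gaussianPDF, gaussianPDF, ← ENNReal.ofReal_mul (gaussianPDFReal_nonneg _ _ _)]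
  congr 1
  have hn : ‖Complex.measurableEquivRealProd.symm p‖ ^ 2 = p.1 ^ 2 + p.2 ^ 2 := by
    rw [← Complex.normSq_eq_norm_sq, Complex.normSq_apply]
    simp [Complex.measurableEquivRealProd_symm_apply, sq]
  rw [hn, gaussianPDFReal, gaussianPDFReal]
  have h3 : (2 * Real.pi * ((1 / 2 : ℝ≥0) : ℝ)) = Real.pi := by
    push_cast; ring
  have h4 : (2 * ((1 / 2 : ℝ≥0) : ℝ)) = 1 := by push_cast; ring
  rw [h3, h4, neg_add, Real.exp_add]
  simp only [sub_zero, div_one]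
  rw [← hpi]
  field_simp
  simp

instance : IsProbabilityMeasure complexGaussian :=
  Measure.isProbabilityMeasure_map (by fun_prop)

theorem integrable_complexGaussian_density :
    Integrable fun z : ℂ => Real.pi⁻¹ * Real.exp (-‖z‖ ^ 2) := by
  have h : (volume.withDensity fun z : ℂ => ENNReal.ofReal (Real.pi⁻¹ * Real.exp (-‖z‖ ^ 2)))
      Set.univ = 1 := by
    rw [← complexGaussian_eq_withDensity, measure_univ]
  rw [withDensity_apply _ MeasurableSet.univ, Measure.restrict_univ] at h
  refine (lintegral_ofReal_ne_top_iff_integrable (by fun_prop)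
    (Eventually.of_forall fun z => by positivity)).mp (by simp [h])

theorem pi_complexGaussian_eq_withDensity (n : ℕ) :
    (Measure.pi fun _ : Fin n => complexGaussian)
      = volume.withDensity fun z : Fin n → ℂ =>
          ENNReal.ofReal (∏ r, Real.pi⁻¹ * Real.exp (-‖z r‖ ^ 2)) := by
  refine Measure.pi_eq fun s hs => ?_
  rw [withDensity_apply _ (MeasurableSet.univ_pi hs), volume_pi, Measure.restrict_pi_pi,
    ← ofReal_integral_eq_lintegral_ofReal
      (Integrable.fintype_prod fun r => integrable_complexGaussian_density.integrableOn)
      (Eventually.of_forall fun z => by positivity),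
    integral_fintype_prod_eq_prod (𝕜 := ℝ) fun _ z => Real.pi⁻¹ * Real.exp (-‖z‖ ^ 2),
    ENNReal.ofReal_prod_of_nonneg fun r _ => integral_nonneg fun z => by positivity]
  refine Finset.prod_congr rfl fun r _ => ?_
  rw [complexGaussian_eq_withDensity, withDensity_apply _ (hs r),
    ofReal_integral_eq_lintegral_ofReal integrable_complexGaussian_density.integrableOn
      (Eventually.of_forall fun z => by positivity)]

/-- The law of a column of the channel matrix. -/
noncomputable def columnLaw (n : ℕ) : Measure (EuclideanSpace ℂ (Fin n)) :=
  (Measure.pi fun _ : Fin n => complexGaussian).map (WithLp.toLp 2)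

instance (n : ℕ) : IsProbabilityMeasure (columnLaw n) :=
  Measure.isProbabilityMeasure_map (by fun_prop)

theorem isStandardGaussian_columnLaw (n : ℕ) : IsStandardGaussian (columnLaw n) := by
  let L : (Fin n → ℂ) ≃L[ℝ] EuclideanSpace ℂ (Fin n) :=
    ((WithLp.linearEquiv 2 ℂ (Fin n → ℂ)).symm.restrictScalars ℝ).toContinuousLinearEquiv
  have hL : ∀ z, L z = WithLp.toLp 2 z := fun z => rfl
  refine ⟨volume.map L, L.isAddHaarMeasure_map volume, ENNReal.ofReal (Real.pi⁻¹ ^ n), ?_⟩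
  ext s hs
  have hpre : MeasurableSet (WithLp.toLp 2 ⁻¹' s : Set (Fin n → ℂ)) := L.continuous.measurable hs
  rw [Measure.smul_apply, withDensity_apply _ hs,
    setLIntegral_map hs (by fun_prop) L.continuous.measurable, columnLaw,
    pi_complexGaussian_eq_withDensity, Measure.map_apply (by fun_prop) hs,
    withDensity_apply _ hpre, smul_eq_mul, ← lintegral_const_mul _ (by fun_prop)]
  refine lintegral_congr fun z => ?_
  rw [hL, ← ENNReal.ofReal_mul (by positivity), EuclideanSpace.norm_sq_eq,
    Finset.prod_mul_distrib, ← Real.exp_sum]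
  simp [Finset.sum_neg_distrib]

/-! ### The joint law of the stream gains -/

/-- The gain `‖v_{i⊥}‖²` of the `i`-th vector of the family `v` after projection onto the orthogonal
complement of the vectors with a larger index; `streamGain H` is `cancellationGain (column H)`. -/
noncomputable def cancellationGain {n m : ℕ} (v : Fin m → EuclideanSpace ℂ (Fin n)) (i : Fin m) :
    ℝ :=
  ‖(Submodule.span ℂ (v '' {j | i < j}))ᗮ.starProjection (v i)‖ ^ 2

theorem cancellationGain_cons_zero {n m : ℕ} (a : EuclideanSpace ℂ (Fin n))
    (v : Fin m → EuclideanSpace ℂ (Fin n)) :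
    cancellationGain (Fin.cons a v : Fin (m + 1) → EuclideanSpace ℂ (Fin n)) 0
      = ‖(Submodule.span ℂ (Set.range v))ᗮ.starProjection a‖ ^ 2 := by
  have h : (Fin.cons a v : Fin (m + 1) → EuclideanSpace ℂ (Fin n)) '' {j | 0 < j}
      = Set.range v := by
    ext w
    constructor
    · rintro ⟨j, hj, rfl⟩
      obtain ⟨j, rfl⟩ := Fin.exists_succ_eq.mpr (ne_of_gt hj)
      exact ⟨j, by simp⟩
    · rintro ⟨j, rfl⟩
      exact ⟨j.succ, Fin.succ_pos j, by simp⟩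
  simp only [cancellationGain, h, Fin.cons_zero]

theorem cancellationGain_cons_succ {n m : ℕ} (a : EuclideanSpace ℂ (Fin n))
    (v : Fin m → EuclideanSpace ℂ (Fin n)) (i : Fin m) :
    cancellationGain (Fin.cons a v : Fin (m + 1) → EuclideanSpace ℂ (Fin n)) i.succ
      = cancellationGain v i := by
  have h : (Fin.cons a v : Fin (m + 1) → EuclideanSpace ℂ (Fin n)) '' {j | i.succ < j}
      = v '' {j | i < j} := by
    ext w
    constructor
    · rintro ⟨j, hj, rfl⟩
      obtain ⟨j, rfl⟩ := Fin.exists_succ_eq.mpr (ne_of_gt ((Fin.succ_pos i).trans hj))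
      exact ⟨j, Fin.succ_lt_succ_iff.mp hj, by simp⟩
    · rintro ⟨j, hj, rfl⟩
      exact ⟨j.succ, Fin.succ_lt_succ_iff.mpr hj, by simp⟩
  simp only [cancellationGain, h, Fin.cons_succ]

/-- The squared distance to a subspace is less than `x` iff some vector of the subspace is at
squared distance less than `x`. -/
theorem norm_sq_orthogonal_starProjection_lt_iff {n : ℕ}
    (V : Submodule ℂ (EuclideanSpace ℂ (Fin n))) (a : EuclideanSpace ℂ (Fin n)) (x : ℝ) :
    ‖Vᗮ.starProjection a‖ ^ 2 < x ↔ ∃ w ∈ V, ‖a - w‖ ^ 2 < x := by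
  constructor
  · intro h
    refine ⟨V.starProjection a, V.starProjection_apply_mem a, ?_⟩
    rwa [← Submodule.starProjection_orthogonal_val]
  · rintro ⟨w, hw, h⟩
    refine lt_of_le_of_lt ?_ h
    have hw0 : Vᗮ.starProjection w = 0 := by
      rw [Submodule.starProjection_orthogonal_val, Submodule.starProjection_eq_self_iff.mpr hw,
        sub_self]
    have : Vᗮ.starProjection a = Vᗮ.starProjection (a - w) := by rw [map_sub, hw0, sub_zero]
    rw [this]
    gcongr
    exact Vᗮ.norm_starProjection_apply_le _

/-- The gain is an infimum, over the coefficients `c`, of functions continuous in `v`; hence it is upper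
semicontinuous although the span may jump. -/
theorem isOpen_cancellationGain_lt {n m : ℕ} (i : Fin m) (x : ℝ) :
    IsOpen {v : Fin m → EuclideanSpace ℂ (Fin n) | cancellationGain v i < x} := by
  have h : {v : Fin m → EuclideanSpace ℂ (Fin n) | cancellationGain v i < x}
      = ⋃ c : Fin m → ℂ, {v | ‖v i - ∑ j ∈ Finset.Ioi i, c j • v j‖ ^ 2 < x} := by
    ext v
    have hI : {j : Fin m | i < j} = (Finset.Ioi i : Finset (Fin m)) := by ext; simp
    simp only [Set.mem_ofPred_eq, Set.mem_iUnion, cancellationGain, hI,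
      norm_sq_orthogonal_starProjection_lt_iff, Submodule.mem_span_image_finset_iff_exists_fun']
    constructor
    · rintro ⟨_, ⟨c, rfl⟩, hc⟩
      exact ⟨c, hc⟩
    · rintro ⟨c, hc⟩
      exact ⟨_, ⟨c, rfl⟩, hc⟩
  rw [h]
  exact isOpen_iUnion fun c => isOpen_lt (by fun_prop) continuous_const

theorem measurableSet_forall_le_cancellationGain {n m : ℕ} (x : Fin m → ℝ) :
    MeasurableSet {v : Fin m → EuclideanSpace ℂ (Fin n) | ∀ i, x i ≤ cancellationGain v i} := by
  rw [Set.ofPred_forall]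
  refine MeasurableSet.iInter fun i => ?_
  have := (isOpen_cancellationGain_lt (n := n) i (x i)).measurableSet.compl
  convert! this using 1
  ext v
  simp

/-- Fubini for the first of `m + 1` independent variables. -/
theorem measure_pi_succ {E : Type*} [MeasurableSpace E] (ν : Measure E) [SigmaFinite ν] {m : ℕ}
    {S : Set (Fin (m + 1) → E)} (hS : MeasurableSet S) :
    Measure.pi (fun _ : Fin (m + 1) => ν) S
      = ∫⁻ v, ν {a | (Fin.cons a v : Fin (m + 1) → E) ∈ S} ∂Measure.pi fun _ : Fin m => ν := by
  have h := (measurePreserving_piFinSuccAbove (fun _ : Fin (m + 1) => ν) 0).symm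
  rw [← h.measure_preimage hS.nullMeasurableSet,
    Measure.prod_apply_symm (h.measurable hS)]
  refine lintegral_congr fun v => ?_
  congr 1
  ext a
  simp only [Set.mem_preimage, Set.mem_ofPred_eq]
  exact iff_of_eq (congrArg (· ∈ S) (Fin.insertNth_zero' a v))

/-- A new column almost surely avoids the proper subspace spanned by the others, as `m < n`. -/
theorem ae_linearIndependent_columnLaw {n : ℕ} : ∀ m : ℕ, m ≤ n →
    ∀ᵐ v ∂Measure.pi fun _ : Fin m => columnLaw n, LinearIndependent ℂ v
  | 0, _ => Eventually.of_forall fun v => linearIndependent_empty_type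
  | m + 1, hm => by
    have hS : MeasurableSet
        {v : Fin (m + 1) → EuclideanSpace ℂ (Fin n) | ¬ LinearIndependent ℂ v} :=
      (isOpen_setOfPred_linearIndependent (𝕜 := ℂ)).measurableSet.compl
    rw [ae_iff, measure_pi_succ _ hS]
    refine lintegral_eq_zero_of_ae_eq_zero ?_
    filter_upwards [ae_linearIndependent_columnLaw m (by omega)] with v hv
    have hV : Submodule.span ℂ (Set.range v) ≠ ⊤ := by
      intro h
      have h1 := finrank_span_eq_card hv
      rw [h, finrank_top, finrank_euclideanSpace_fin, Fintype.card_fin] at h1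
      omega
    rw [Pi.zero_apply]
    convert (isStandardGaussian_columnLaw n).measure_submodule _ hV using 2
    ext a
    simp [linearIndependent_finCons, hv]

/-- The gains are independent, and the `i`-th one has the Gamma law of shape `n - m + i + 1`, the
dimension of the orthogonal complement of the `m - 1 - i` vectors with a larger index. -/
theorem measure_forall_le_cancellationGain {n : ℕ} : ∀ m : ℕ, m ≤ n → ∀ x : Fin m → ℝ,
    (∀ i, 0 ≤ x i) →
    Measure.pi (fun _ : Fin m => columnLaw n) {v | ∀ i, x i ≤ cancellationGain v i}
      = ∏ i : Fin m, ENNReal.ofReal (gammaTail (n - m + i + 1) (x i))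
  | 0, _, x, _ => by simp
  | m + 1, hm, x, hx => by
    rw [measure_pi_succ _ (measurableSet_forall_le_cancellationGain x), Fin.prod_univ_succ]
    have ih := measure_forall_le_cancellationGain (n := n) m (by omega) (fun i => x i.succ)
      fun i => hx i.succ
    have hidx : ∀ i : Fin m, n - (m + 1) + (i.succ : ℕ) + 1 = n - m + i + 1 := fun i => by
      rw [Fin.val_succ]; omega
    simp_rw [hidx]
    rw [← ih, ← lintegral_indicator_one (measurableSet_forall_le_cancellationGain _),
      ← lintegral_const_mul _
        (measurable_one.indicator (measurableSet_forall_le_cancellationGain _))]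
    refine lintegral_congr_ae ?_
    filter_upwards [ae_linearIndependent_columnLaw (n := n) m (by omega)] with v hv
    have hrank : Module.finrank ℂ ↥(Submodule.span ℂ (Set.range v))ᗮ = n - (m + 1) + 1 := by
      have h1 := (Submodule.span ℂ (Set.range v)).finrank_add_finrank_orthogonal
      rw [finrank_span_eq_card hv, finrank_euclideanSpace_fin, Fintype.card_fin] at h1
      omega
    have hlaw := (isStandardGaussian_columnLaw n).measure_le_norm_sq_starProjection _
      (Nat.succ_pos _) hrank (hx 0)
    simp only [Fin.forall_fin_succ, cancellationGain_cons_zero,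
      cancellationGain_cons_succ, Fin.val_zero, add_zero]
    by_cases h : ∀ i : Fin m, x i.succ ≤ cancellationGain v i
    · rw [Set.indicator_of_mem (by exact h)]
      simpa [h] using hlaw
    · rw [Set.indicator_of_notMem (by exact h)]
      simp [h]

theorem map_curry_pi {n m : ℕ} {E : Type*} [MeasurableSpace E] (ν : Measure E)
    [IsProbabilityMeasure ν] :
    (Measure.pi fun _ : Fin n × Fin m => ν).map (fun z i r => z (r, i))
      = Measure.pi fun _ : Fin m => Measure.pi fun _ : Fin n => ν := by
  have hU : Measurable fun (y : Fin m → Fin n → E) (p : Fin n × Fin m) => y p.2 p.1 := by fun_prop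
  have hC : Measurable fun (z : Fin n × Fin m → E) (i : Fin m) (r : Fin n) => z (r, i) := by
    fun_prop
  have h : Measure.pi (fun _ : Fin n × Fin m => ν)
      = (Measure.pi fun _ : Fin m => Measure.pi fun _ : Fin n => ν).map
          fun y p => y p.2 p.1 := by
    refine Measure.pi_eq fun s hs => ?_
    rw [Measure.map_apply hU (MeasurableSet.univ_pi hs)]
    have hpre : (fun (y : Fin m → Fin n → E) (p : Fin n × Fin m) => y p.2 p.1) ⁻¹' Set.univ.pi s
        = Set.univ.pi fun i => Set.univ.pi fun r => s (r, i) := by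
      ext y
      simp only [Set.mem_preimage, Set.mem_univ_pi]
      exact ⟨fun h i r => h (r, i), fun h p => h p.2 p.1⟩
    rw [hpre, Measure.pi_pi]
    simp_rw [Measure.pi_pi]
    rw [Fintype.prod_prod_type_right]
  rw [h, Measure.map_map hC hU]
  exact Measure.map_id

theorem IsIIDRayleigh.aemeasurable_column {Ω : Type*} [MeasurableSpace Ω] {n m : ℕ}
    {H : Ω → Matrix (Fin n) (Fin m) ℂ} {μ : Measure Ω} (hH : IsIIDRayleigh H μ) :
    AEMeasurable (fun ω => column (H ω)) μ := by
  have h1 : AEMeasurable (fun ω (p : Fin n × Fin m) => H ω p.1 p.2) μ :=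
    aemeasurable_pi_lambda _ fun p => (hH.law p.1 p.2).aemeasurable
  have h2 : Measurable fun (z : Fin n × Fin m → ℂ) (i : Fin m) =>
      (WithLp.toLp 2 fun r => z (r, i) : EuclideanSpace ℂ (Fin n)) := by fun_prop
  exact h2.comp_aemeasurable h1

/-- The columns of an i.i.d. Rayleigh channel are independent with law `columnLaw n`. -/
theorem IsIIDRayleigh.map_column {Ω : Type*} [MeasurableSpace Ω] {n m : ℕ}
    {H : Ω → Matrix (Fin n) (Fin m) ℂ} {μ : Measure Ω} [IsProbabilityMeasure μ]
    (hH : IsIIDRayleigh H μ) :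
    μ.map (fun ω => column (H ω)) = Measure.pi fun _ : Fin m => columnLaw n := by
  have h1 : AEMeasurable (fun ω (p : Fin n × Fin m) => H ω p.1 p.2) μ :=
    aemeasurable_pi_lambda _ fun p => (hH.law p.1 p.2).aemeasurable
  have hlaw : μ.map (fun ω (p : Fin n × Fin m) => H ω p.1 p.2)
      = Measure.pi fun _ : Fin n × Fin m => complexGaussian := by
    have hind := hH.indep
    rw [iIndepFun_iff_map_fun_eq_pi_map fun p : Fin n × Fin m =>
      (hH.law p.1 p.2).aemeasurable] at hind
    refine hind.trans ?_
    congr 1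
    ext1 p
    exact (hH.law p.1 p.2).map_eq
  have hC : Measurable fun (z : Fin n × Fin m → ℂ) (i : Fin m) (r : Fin n) => z (r, i) := by
    fun_prop
  have hT : Measurable fun (y : Fin m → Fin n → ℂ) (i : Fin m) =>
      (WithLp.toLp 2 (y i) : EuclideanSpace ℂ (Fin n)) := by fun_prop
  have hcomp : (fun ω => column (H ω))
      = (fun (y : Fin m → Fin n → ℂ) (i : Fin m) =>
          (WithLp.toLp 2 (y i) : EuclideanSpace ℂ (Fin n))) ∘
        (fun (z : Fin n × Fin m → ℂ) (i : Fin m) (r : Fin n) => z (r, i)) ∘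
        fun ω (p : Fin n × Fin m) => H ω p.1 p.2 := rfl
  rw [hcomp, ← AEMeasurable.map_map_of_aemeasurable hT.aemeasurable
      (hC.comp_aemeasurable h1), ← AEMeasurable.map_map_of_aemeasurable hC.aemeasurable h1,
    hlaw, map_curry_pi]
  have : ∀ i : Fin m, SigmaFinite (((fun _ : Fin m => Measure.pi fun _ : Fin n =>
      complexGaussian) i).map (WithLp.toLp 2 : (Fin n → ℂ) → EuclideanSpace ℂ (Fin n))) :=
    fun i => inferInstanceAs (SigmaFinite (columnLaw n))
  exact Measure.pi_map_pi fun i => (by fun_prop)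

theorem streamCapacity_lt_iff {n m : ℕ} {R γ₀ : ℝ} (hγ : 0 < γ₀) {α : Fin m → ℝ} {i : Fin m}
    (hα : 0 < α i) (H : Matrix (Fin n) (Fin m) ℂ) :
    streamCapacity γ₀ α H i < R ↔
      cancellationGain (column H) i < (Real.exp R - 1) / γ₀ / α i := by
  have hg : 0 ≤ streamGain H i := sq_nonneg _
  have hdef : streamGain H i = cancellationGain (column H) i := rfl
  rw [streamCapacity, Real.log_lt_iff_lt_exp (by positivity), ← hdef, div_div,
    lt_div_iff₀ (by positivity)]
  constructor <;> intro h <;> nlinarith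

/-- A stream without power is always in outage; otherwise the streams fail independently. -/
theorem outageProb_eq {Ω : Type*} [MeasurableSpace Ω] {n m : ℕ} (hmn : m ≤ n) {μ : Measure Ω}
    [IsProbabilityMeasure μ] {H : Ω → Matrix (Fin n) (Fin m) ℂ} (hH : IsIIDRayleigh H μ) {R : ℝ}
    (hR : 0 < R) {γ₀ : ℝ} (hγ : 0 < γ₀) {α : Fin m → ℝ} (hα : ∀ i, 0 ≤ α i) :
    outageProb μ H R γ₀ α
      = 1 - ∏ i : Fin m, reliability (n - m + i + 1) ((Real.exp R - 1) / γ₀) (α i) := by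
  have hc : 0 < Real.exp R - 1 := by linarith [Real.add_one_lt_exp hR.ne']
  by_cases hpos : ∀ i, 0 < α i
  · set x : Fin m → ℝ := fun i => (Real.exp R - 1) / γ₀ / α i with hx
    have hx0 : ∀ i, 0 ≤ x i := fun i => div_nonneg (by positivity) (hα i)
    have hset : {ω | ∃ i, streamCapacity γ₀ α (H ω) i < R}
        = ((fun ω => column (H ω)) ⁻¹' {v | ∀ i, x i ≤ cancellationGain v i})ᶜ := by
      ext ω
      simp only [Set.mem_ofPred_eq, Set.mem_compl_iff, Set.mem_preimage, not_forall, not_le]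
      exact exists_congr fun i => streamCapacity_lt_iff hγ (hpos i) (H ω)
    have hmeas := measurableSet_forall_le_cancellationGain (n := n) x
    have hnull := hH.aemeasurable_column.nullMeasurableSet_preimage hmeas
    rw [outageProb, hset, probReal_compl_eq_one_sub₀ hnull, measureReal_def,
      ← Measure.map_apply_of_aemeasurable hH.aemeasurable_column hmeas, hH.map_column,
      measure_forall_le_cancellationGain m hmn x hx0,
      ← ENNReal.ofReal_prod_of_nonneg fun i _ => (gammaTail_pos (Nat.succ_pos _) (hx0 i)).le,
      ENNReal.toReal_ofReal (Finset.prod_nonneg fun i _ =>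
        (gammaTail_pos (Nat.succ_pos _) (hx0 i)).le)]
    congr 1
    exact Finset.prod_congr rfl fun i _ => (reliability_of_pos _ _ (hpos i)).symm
  · push Not at hpos
    obtain ⟨i, hi⟩ := hpos
    have h0 : α i = 0 := le_antisymm hi (hα i)
    have hset : {ω | ∃ i, streamCapacity γ₀ α (H ω) i < R} = Set.univ := by
      refine Set.eq_univ_of_forall fun ω => ⟨i, ?_⟩
      simpa [streamCapacity, h0] using hR
    rw [outageProb, hset, probReal_univ,
      Finset.prod_eq_zero (Finset.mem_univ i) (reliability_of_nonpos _ _ hi), sub_zero]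

/-! ### Optimal allocations and their high-SNR asymptotics -/

theorem isCompact_allocations (m : ℕ) : IsCompact (allocations m) := by
  refine (isCompact_Icc (a := (0 : Fin m → ℝ)) (b := fun _ => (m : ℝ))).of_isClosed_subset ?_ ?_
  · have h : allocations m = (⋂ i, {α : Fin m → ℝ | 0 ≤ α i}) ∩ {α | ∑ i, α i = m} := by
      ext α
      simp [allocations]
    rw [h]
    exact (isClosed_iInter fun i => isClosed_le continuous_const (by fun_prop)).inter
      (isClosed_eq (by fun_prop) continuous_const)
  · rintro α ⟨h0, hsum⟩
    refine ⟨h0, fun i => ?_⟩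
    rw [← hsum]
    exact Finset.single_le_sum (fun j _ => h0 j) (Finset.mem_univ i)

theorem one_mem_allocations (m : ℕ) : (fun _ => 1 : Fin m → ℝ) ∈ allocations m :=
  ⟨fun _ => zero_le_one, by simp⟩

theorem exists_isMaxOn_prod_reliability {m : ℕ} (κ : Fin m → ℕ) {s : ℝ} (hs : 0 < s) :
    ∃ α ∈ allocations m,
      IsMaxOn (fun α : Fin m → ℝ => ∏ i, reliability (κ i + 1) s (α i)) (allocations m) α := by
  refine (isCompact_allocations m).exists_isMaxOn ⟨_, one_mem_allocations m⟩ ?_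
  exact (continuous_finsetProd _ fun i _ =>
    (continuous_reliability (κ i + 1) hs).comp (continuous_apply i)).continuousOn

theorem pos_of_isMaxOn_prod_reliability {m : ℕ} {κ : Fin m → ℕ} {s : ℝ} (hs : 0 < s)
    {α : Fin m → ℝ}
    (hmax : IsMaxOn (fun α : Fin m → ℝ => ∏ i, reliability (κ i + 1) s (α i)) (allocations m) α)
    (i : Fin m) : 0 < α i := by
  by_contra! hi
  have h1 : ∏ l, reliability (κ l + 1) s 1 ≤ ∏ l, reliability (κ l + 1) s (α l) :=
    hmax (one_mem_allocations m)
  rw [Finset.prod_eq_zero (f := fun l => reliability (κ l + 1) s (α l)) (Finset.mem_univ i)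
    (reliability_of_nonpos _ _ hi)] at h1
  exact absurd h1 (not_le.mpr
    (Finset.prod_pos fun j _ => reliability_pos (Nat.succ_pos _) hs zero_lt_one))

/-- The first-order condition for maximizing the success probability over the allocations. In terms
of the thresholds `x_i = s / α_i` it says that `x_i ^ 2 h_i(x_i)`, with `h_i` the hazard rate of the
Gamma law of shape `κ i + 1`, does not depend on `i`; the denominators of the hazard rates are
cleared and the exponentials cancelled. -/
def IsStationary {m : ℕ} (κ : Fin m → ℕ) (s : ℝ) (α : Fin m → ℝ) : Prop :=
  ∀ i j, (s / α i) ^ (κ i + 2) / ((κ i).factorial : ℝ) * expPartialSum (κ j + 1) (s / α j)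
    = (s / α j) ^ (κ j + 2) / ((κ j).factorial : ℝ) * expPartialSum (κ i + 1) (s / α i)

/-- At an optimum, shifting a little power from stream `j` to stream `i` does not change the
success probability to first order. -/
theorem stationary_of_isMaxOn {m : ℕ} {κ : Fin m → ℕ} {s : ℝ} (hs : 0 < s) {α : Fin m → ℝ}
    (hα : α ∈ allocations m)
    (hmax : IsMaxOn (fun α : Fin m → ℝ => ∏ i, reliability (κ i + 1) s (α i)) (allocations m) α) :
    IsStationary κ s α := by
  intro i j
  rcases eq_or_ne i j with rfl | hij
  · rfl
  have hpos := pos_of_isMaxOn_prod_reliability hs hmax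
  set f : ℝ → ℝ := fun t =>
    reliability (κ i + 1) s (α i + t) * reliability (κ j + 1) s (α j - t) with hf
  set C : ℝ := ∏ l ∈ (Finset.univ.erase i).erase j, reliability (κ l + 1) s (α l) with hC
  have hCpos : 0 < C := Finset.prod_pos fun l _ => reliability_pos (Nat.succ_pos _) hs (hpos l)
  set β : ℝ → Fin m → ℝ := fun t => α + t • (Pi.single i 1 - Pi.single j 1) with hβ
  have hβi : ∀ t, β t i = α i + t := fun t => by simp [hβ, hij]
  have hβj : ∀ t, β t j = α j - t := fun t => by simp [hβ, hij.symm, sub_eq_add_neg]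
  have hβl : ∀ t l, l ≠ i → l ≠ j → β t l = α l := fun t l h1 h2 => by simp [hβ, h1, h2]
  have hprod : ∀ t, ∏ l, reliability (κ l + 1) s (β t l) = f t * C := by
    intro t
    rw [← Finset.mul_prod_erase _ _ (Finset.mem_univ i), ← Finset.mul_prod_erase _ _
      (Finset.mem_erase.mpr ⟨hij.symm, Finset.mem_univ j⟩), hβi, hβj, ← mul_assoc]
    congr 1
    refine Finset.prod_congr rfl fun l hl => ?_
    simp only [Finset.mem_erase, Finset.mem_univ, and_true] at hl
    rw [hβl t l hl.2 hl.1]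
  have hloc : IsLocalMax f 0 := by
    have hev : ∀ᶠ t : ℝ in 𝓝 0, t ∈ Set.Ioo (-α i) (α j) :=
      Ioo_mem_nhds (by linarith [hpos i]) (hpos j)
    filter_upwards [hev] with t ht
    have hmem : β t ∈ allocations m := by
      refine ⟨fun l => ?_, ?_⟩
      · by_cases h1 : l = i
        · rw [h1, hβi]; linarith [ht.1]
        · by_cases h2 : l = j
          · rw [h2, hβj]; linarith [ht.2]
          · rw [hβl t l h1 h2]; exact hα.1 l
      · simp [hβ, Finset.sum_add_distrib, ← Finset.mul_sum, hα.2]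
    have h := hmax hmem
    simp only [Set.mem_ofPred_eq] at h
    have h0 : β 0 = α := by simp [hβ]
    have h00 := hprod 0
    rw [h0] at h00
    rw [hprod t, h00] at h
    exact le_of_mul_le_mul_right h hCpos
  -- The derivative of each factor is `exp (-x) x ^ κ / κ! * x ^ 2 / s` with `x = s / α`.
  have hd1 : HasDerivAt (fun t => reliability (κ i + 1) s (α i + t)) _ 0 :=
    HasDerivAt.comp_const_add (α i) 0 (by
      simpa only [add_zero] using hasDerivAt_reliability (κ i) s (hpos i))
  have hd2 : HasDerivAt (fun t => reliability (κ j + 1) s (α j - t)) _ 0 :=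
    HasDerivAt.comp_const_sub (α j) 0 (by
      simpa only [sub_zero] using hasDerivAt_reliability (κ j) s (hpos j))
  have hder := hloc.hasDerivAt_eq_zero (hd1.mul hd2)
  simp only [add_zero, sub_zero] at hder
  rw [reliability_of_pos _ _ (hpos i), reliability_of_pos _ _ (hpos j)] at hder
  simp only [gammaTail] at hder
  have hsq : ∀ l, s / α l ^ 2 = (s / α l) ^ 2 / s := fun l => by
    have := (hpos l).ne'
    field_simp
  rw [hsq i, hsq j] at hder
  have he : Real.exp (-(s / α i)) * Real.exp (-(s / α j)) / s ≠ 0 := by positivity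
  refine mul_left_cancel₀ he ?_
  rw [← sub_eq_zero, ← hder]
  ring

/-- The function `x ^ (k + 2) / expPartialSum (k + 1) x` is monotone on `[0, ∞)`. -/
theorem pow_mul_expPartialSum_le (k : ℕ) {ε x : ℝ} (hε : 0 ≤ ε) (hx : ε ≤ x) :
    ε ^ (k + 2) * expPartialSum (k + 1) x ≤ x ^ (k + 2) * expPartialSum (k + 1) ε := by
  simp only [expPartialSum, Finset.mul_sum]
  refine Finset.sum_le_sum fun j hj => ?_
  have hj' : j ≤ k + 2 := by have := Finset.mem_range.mp hj; omega
  obtain ⟨d, hd⟩ := Nat.exists_eq_add_of_le hj'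
  have hx0 := hε.trans hx
  rw [hd, ← mul_div_assoc, ← mul_div_assoc]
  gcongr ?_ / _
  calc ε ^ (j + d) * x ^ j = ε ^ j * x ^ j * ε ^ d := by ring
    _ ≤ ε ^ j * x ^ j * x ^ d := by gcongr
    _ = x ^ (j + d) * ε ^ j := by ring

theorem isEquivalent_rpow_of_eventually_nonneg {ι : Type*} {l : Filter ι} {u v : ι → ℝ}
    (h : u ~[l] v) (hv : ∀ᶠ t in l, 0 ≤ v t) (r : ℝ) :
    (fun t => u t ^ r) ~[l] fun t => v t ^ r := by
  have habs : v =ᶠ[l] fun t => |v t| := by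
    filter_upwards [hv] with t ht using (abs_of_nonneg ht).symm
  have h1 : (fun t => u t ^ r) ~[l] fun t => |v t| ^ r :=
    IsEquivalent.rpow (v := fun t => |v t|) (fun t => abs_nonneg (v t)) (h.congr_right habs)
  refine h1.congr_right ?_
  filter_upwards [hv] with t ht
  rw [abs_of_nonneg ht]

section HighSNR

variable {m : ℕ} {κ : Fin m → ℕ} {c : ℝ} {α : ℝ → Fin m → ℝ}

/-- At least one stream has power `≥ 1`, so that `x_j = c / (γ α_j) ≤ c / γ` for some `j`; the
first-order condition transfers the decay to all streams. -/
theorem tendsto_threshold_zero (hm : 0 < m) (hc : 0 < c)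
    (hα : ∀ γ, 0 < γ → α γ ∈ allocations m) (hpos : ∀ γ, 0 < γ → ∀ i, 0 < α γ i)
    (hst : ∀ γ, 0 < γ → IsStationary κ (c / γ) (α γ)) (i : Fin m) :
    Tendsto (fun γ => c / γ / α γ i) atTop (𝓝 0) := by
  have hδ : Tendsto (fun γ : ℝ => c / γ) atTop (𝓝 0) := tendsto_const_nhds.div_atTop tendsto_id
  rw [Metric.tendsto_atTop']
  suffices h : ∀ ε > 0, ∀ᶠ γ in atTop, dist (c / γ / α γ i) 0 < ε by
    intro ε hε
    obtain ⟨N, hN⟩ := eventually_atTop.mp (h ε hε)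
    exact ⟨N, fun γ hγ => hN γ hγ.le⟩
  intro ε hε
  have hT : 0 < expPartialSum (κ i + 1) ε :=
    zero_lt_one.trans_le (one_le_expPartialSum (Nat.succ_pos _) hε.le)
  have hsmall : ∀ᶠ γ : ℝ in atTop,
      (κ i).factorial * (c / γ) ^ 2 * expPartialSum (κ i + 1) ε < ε ^ (κ i + 2) := by
    have : Tendsto (fun γ : ℝ => (κ i).factorial * (c / γ) ^ 2 * expPartialSum (κ i + 1) ε) atTop
        (𝓝 ((κ i).factorial * 0 ^ 2 * expPartialSum (κ i + 1) ε)) :=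
      ((hδ.pow 2).const_mul _).mul_const _
    exact this.eventually_lt_const (by simp; positivity)
  filter_upwards [hsmall, eventually_gt_atTop 0, hδ.eventually_le_const zero_lt_one]
    with γ hγs hγ hγ1
  have hx : ∀ l, 0 < c / γ / α γ l := fun l => by have := hpos γ hγ l; positivity
  rw [Real.dist_0_eq_abs, abs_of_pos (hx i)]
  by_contra! hge
  obtain ⟨j, hj⟩ : ∃ j, 1 ≤ α γ j := by
    by_contra! hlt
    have : Nonempty (Fin m) := ⟨⟨0, hm⟩⟩
    have h1 := Finset.sum_lt_sum_of_nonempty (Finset.univ_nonempty (α := Fin m))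
      fun l _ => hlt l
    rw [(hα γ hγ).2] at h1
    simp at h1
  have hxj : c / γ / α γ j ≤ c / γ := div_le_self (by positivity) hj
  set x := c / γ / α γ i with hxdef
  set y := c / γ / α γ j with hydef
  have hTx : 0 < expPartialSum (κ i + 1) x :=
    zero_lt_one.trans_le (one_le_expPartialSum (Nat.succ_pos _) (hx i).le)
  -- The common value in the first-order condition is `O((c / γ) ^ 2)`.
  have hy2 : y ^ (κ j + 2) / ((κ j).factorial : ℝ) ≤ (c / γ) ^ 2 := by
    have hf1 : (1 : ℝ) ≤ (κ j).factorial := by exact_mod_cast (κ j).factorial_pos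
    calc y ^ (κ j + 2) / ((κ j).factorial : ℝ) ≤ y ^ (κ j + 2) :=
          div_le_self (pow_nonneg (hx j).le _) hf1
      _ ≤ y ^ 2 := pow_le_pow_of_le_one (hx j).le (hxj.trans hγ1) (by omega)
      _ ≤ (c / γ) ^ 2 := by have := (hx j).le; gcongr
  have hxi : x ^ (κ i + 2) ≤ (κ i).factorial * (c / γ) ^ 2 * expPartialSum (κ i + 1) x := by
    have hfi : (0 : ℝ) < (κ i).factorial := by exact_mod_cast (κ i).factorial_pos
    have h1 : x ^ (κ i + 2) / ((κ i).factorial : ℝ)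
        ≤ (c / γ) ^ 2 * expPartialSum (κ i + 1) x := by
      calc x ^ (κ i + 2) / ((κ i).factorial : ℝ)
          ≤ x ^ (κ i + 2) / ((κ i).factorial : ℝ) * expPartialSum (κ j + 1) y :=
            le_mul_of_one_le_right (by have := (hx i).le; positivity)
              (one_le_expPartialSum (Nat.succ_pos _) (hx j).le)
        _ = y ^ (κ j + 2) / ((κ j).factorial : ℝ) * expPartialSum (κ i + 1) x := hst γ hγ i j
        _ ≤ _ := by gcongr
    rw [div_le_iff₀ hfi] at h1
    linarith
  have hmono := pow_mul_expPartialSum_le (κ i) hε.le hge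
  have h2 : ε ^ (κ i + 2) * expPartialSum (κ i + 1) x
      ≤ (κ i).factorial * (c / γ) ^ 2 * expPartialSum (κ i + 1) ε * expPartialSum (κ i + 1) x := by
    calc _ ≤ x ^ (κ i + 2) * expPartialSum (κ i + 1) ε := hmono
      _ ≤ (κ i).factorial * (c / γ) ^ 2 * expPartialSum (κ i + 1) x
          * expPartialSum (κ i + 1) ε := by gcongr
      _ = _ := by ring
  exact absurd (le_of_mul_le_mul_right h2 hTx) (not_le.mpr hγs)

/-- The asymptotic form of the first-order condition: the thresholds `x_i` and `x_z` satisfy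
`x_i ^ (κ i + 2) / (κ i)! ~ x_z ^ (κ z + 2) / (κ z)!`, solved for `x_i`. -/
theorem isEquivalent_threshold (hm : 0 < m) (hc : 0 < c)
    (hα : ∀ γ, 0 < γ → α γ ∈ allocations m) (hpos : ∀ γ, 0 < γ → ∀ i, 0 < α γ i)
    (hst : ∀ γ, 0 < γ → IsStationary κ (c / γ) (α γ)) (i z : Fin m) :
    (fun γ => c / γ / α γ i) ~[atTop] fun γ =>
      (((κ i).factorial : ℝ) / (κ z).factorial) ^ ((κ i + 2 : ℝ)⁻¹)
        * (c / γ / α γ z) ^ ((κ z + 2 : ℝ) / (κ i + 2)) := by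
  have hT : ∀ l, Tendsto (fun γ => expPartialSum (κ l + 1) (c / γ / α γ l)) atTop (𝓝 1) := by
    intro l
    have := (continuous_expPartialSum (κ l + 1)).tendsto 0
    rw [expPartialSum_zero (Nat.succ_pos _)] at this
    exact this.comp (tendsto_threshold_zero hm hc hα hpos hst l)
  have hfac : ∀ l, (0 : ℝ) < (κ l).factorial := fun l => by exact_mod_cast (κ l).factorial_pos
  have h1 : (fun γ => (c / γ / α γ i) ^ (κ i + 2)) ~[atTop] fun γ =>
      ((κ i).factorial : ℝ) / (κ z).factorial * (c / γ / α γ z) ^ (κ z + 2) := by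
    rw [isEquivalent_iff_exists_eq_mul]
    refine ⟨fun γ => expPartialSum (κ i + 1) (c / γ / α γ i)
      / expPartialSum (κ z + 1) (c / γ / α γ z), ?_, ?_⟩
    · simpa only [div_one] using! (hT i).div (hT z) one_ne_zero
    · filter_upwards [eventually_gt_atTop 0] with γ hγ
      have hz := hpos γ hγ z
      have hTz : 0 < expPartialSum (κ z + 1) (c / γ / α γ z) :=
        zero_lt_one.trans_le (one_le_expPartialSum (Nat.succ_pos _) (by positivity))
      have h := hst γ hγ i z
      have hi := (hfac i).ne'
      rw [Pi.mul_apply, div_mul_eq_mul_div, eq_div_iff hTz.ne']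
      calc (c / γ / α γ i) ^ (κ i + 2) * expPartialSum (κ z + 1) (c / γ / α γ z)
          = (κ i).factorial * ((c / γ / α γ i) ^ (κ i + 2) / ((κ i).factorial : ℝ)
            * expPartialSum (κ z + 1) (c / γ / α γ z)) := by field_simp
        _ = _ := by rw [h]; ring
  have hxpos : ∀ l, ∀ᶠ γ in atTop, 0 < c / γ / α γ l := by
    intro l
    filter_upwards [eventually_gt_atTop 0] with γ hγ
    have := hpos γ hγ l
    positivity
  have h2 := isEquivalent_rpow_of_eventually_nonneg h1
    (by filter_upwards [hxpos z] with γ hγ; positivity) ((κ i + 2 : ℝ)⁻¹)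
  refine (h2.congr_left ?_).congr_right ?_
  · filter_upwards [hxpos i] with γ hγ
    rw [← Real.rpow_natCast, ← Real.rpow_mul hγ.le]
    push_cast
    rw [mul_inv_cancel₀ (by positivity), Real.rpow_one]
  · filter_upwards [hxpos z] with γ hγ
    rw [Real.mul_rpow (by positivity) (by positivity), ← Real.rpow_natCast,
      ← Real.rpow_mul hγ.le]
    push_cast
    rw [div_eq_mul_inv (κ z + 2 : ℝ)]

/-- If stream `z` has the least diversity order, every other stream gets a vanishing share of
the power. -/
theorem tendsto_power_zero (hm : 0 < m) (hc : 0 < c)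
    (hα : ∀ γ, 0 < γ → α γ ∈ allocations m) (hpos : ∀ γ, 0 < γ → ∀ i, 0 < α γ i)
    (hst : ∀ γ, 0 < γ → IsStationary κ (c / γ) (α γ)) {i z : Fin m} (hiz : κ z < κ i) :
    Tendsto (fun γ => α γ i) atTop (𝓝 0) := by
  have hfac : ∀ l, (0 : ℝ) < (κ l).factorial := fun l => by exact_mod_cast (κ l).factorial_pos
  set q : ℝ := (κ z + 2 : ℝ) / (κ i + 2) with hq
  have hq1 : 0 < 1 - q := by
    have : (κ z : ℝ) < κ i := by exact_mod_cast hiz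
    rw [hq, sub_pos, div_lt_one (by positivity)]
    linarith
  set K : ℝ := (((κ i).factorial : ℝ) / (κ z).factorial) ^ ((κ i + 2 : ℝ)⁻¹) with hK
  have hKpos : 0 < K := Real.rpow_pos_of_pos (div_pos (hfac i) (hfac z)) _
  have hx := isEquivalent_threshold hm hc hα hpos hst i z
  -- The left-hand side is `α_i / α_z`, and the exponent `1 - q` is positive since `κ z < κ i`.
  have hratio : (fun γ => (c / γ / α γ z) / (c / γ / α γ i)) ~[atTop]
      fun γ => K⁻¹ * (c / γ / α γ z) ^ (1 - q) := by
    refine ((IsEquivalent.refl (u := fun γ => c / γ / α γ z)).div hx).congr_right ?_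
    filter_upwards [eventually_gt_atTop 0] with γ hγ
    have := hpos γ hγ z
    have h0 : 0 < c / γ / α γ z := by positivity
    rw [Pi.div_apply, Real.rpow_sub h0, Real.rpow_one, ← hK, ← hq]
    field_simp
  have hlim : Tendsto (fun γ => K⁻¹ * (c / γ / α γ z) ^ (1 - q)) atTop (𝓝 0) := by
    have := ((tendsto_threshold_zero hm hc hα hpos hst z).rpow_const
      (Or.inr hq1.le)).const_mul K⁻¹
    simpa [Real.zero_rpow hq1.ne'] using this
  have hr := (hratio.symm.tendsto_nhds hlim).const_mul (m : ℝ)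
  rw [mul_zero] at hr
  refine squeeze_zero' ?_ ?_ hr
  · filter_upwards [eventually_gt_atTop 0] with γ hγ using (hpos γ hγ i).le
  · filter_upwards [eventually_gt_atTop 0] with γ hγ
    have hi := hpos γ hγ i
    have hz := hpos γ hγ z
    have hzm : α γ z ≤ m := by
      rw [← (hα γ hγ).2]
      exact Finset.single_le_sum (fun j _ => (hα γ hγ).1 j) (Finset.mem_univ z)
    have : (c / γ / α γ z) / (c / γ / α γ i) = α γ i / α γ z := by field_simp
    rw [this, ← mul_div_assoc, le_div_iff₀ hz]
    nlinarith

/-- The stream with the least diversity order gets almost all the power. -/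
theorem tendsto_power_of_least (hm : 0 < m) (hc : 0 < c)
    (hα : ∀ γ, 0 < γ → α γ ∈ allocations m) (hpos : ∀ γ, 0 < γ → ∀ i, 0 < α γ i)
    (hst : ∀ γ, 0 < γ → IsStationary κ (c / γ) (α γ)) {z : Fin m} (hz : ∀ i, i ≠ z → κ z < κ i) :
    Tendsto (fun γ => α γ z) atTop (𝓝 (m : ℝ)) := by
  have h : Tendsto (fun γ => (m : ℝ) - ∑ i ∈ Finset.univ.erase z, α γ i) atTop
      (𝓝 (m - ∑ i ∈ Finset.univ.erase z, (0 : ℝ))) :=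
    tendsto_const_nhds.sub (tendsto_finsetSum _ fun i hi =>
      tendsto_power_zero hm hc hα hpos hst (hz i (Finset.ne_of_mem_erase hi)))
  rw [Finset.sum_const_zero, sub_zero] at h
  refine h.congr' ?_
  filter_upwards [eventually_gt_atTop 0] with γ hγ
  rw [← (hα γ hγ).2, ← Finset.add_sum_erase _ _ (Finset.mem_univ z)]
  ring

/-- The power is `α_i = (c / γ) / x_i`, where `x_z ~ c / (γ m)` is known from `α_z → m`. -/
theorem isEquivalent_power (hm : 0 < m) (hc : 0 < c)
    (hα : ∀ γ, 0 < γ → α γ ∈ allocations m) (hpos : ∀ γ, 0 < γ → ∀ i, 0 < α γ i)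
    (hst : ∀ γ, 0 < γ → IsStationary κ (c / γ) (α γ)) {z : Fin m} (hz : ∀ i, i ≠ z → κ z < κ i)
    (i : Fin m) :
    (fun γ => α γ i) ~[atTop] fun γ =>
      c / γ / ((((κ i).factorial : ℝ) / (κ z).factorial) ^ ((κ i + 2 : ℝ)⁻¹)
        * (c / γ / m) ^ ((κ z + 2 : ℝ) / (κ i + 2))) := by
  have hm0 : (0 : ℝ) < m := by exact_mod_cast hm
  have h1 : (fun γ => α γ z) ~[atTop] fun _ => (m : ℝ) :=
    (isEquivalent_const_iff_tendsto hm0.ne').mpr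
      (tendsto_power_of_least hm hc hα hpos hst hz)
  have h2 : (fun γ => c / γ / α γ z) ~[atTop] fun γ => c / γ / m :=
    (IsEquivalent.refl (u := fun γ : ℝ => c / γ)).div h1
  have h3 := isEquivalent_rpow_of_eventually_nonneg h2
    (by filter_upwards [eventually_gt_atTop 0] with γ hγ; positivity)
    ((κ z + 2 : ℝ) / (κ i + 2))
  have h4 := (isEquivalent_threshold hm hc hα hpos hst i z).trans
    ((IsEquivalent.refl (u := fun _ : ℝ =>
      (((κ i).factorial : ℝ) / (κ z).factorial) ^ ((κ i + 2 : ℝ)⁻¹))).mul h3)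
  refine ((IsEquivalent.refl (u := fun γ : ℝ => c / γ)).div h4).congr_left ?_
  filter_upwards [eventually_gt_atTop 0] with γ hγ
  have := hpos γ hγ i
  rw [Pi.div_apply]
  field_simp

end HighSNR

theorem isEquivalent_sum_of_nonneg {ι X : Type*} {l : Filter X} (s : Finset ι) {u v : ι → X → ℝ}
    (huv : ∀ i ∈ s, u i ~[l] v i) (hv : ∀ i ∈ s, ∀ᶠ t in l, 0 ≤ v i t) :
    (fun t => ∑ i ∈ s, u i t) ~[l] fun t => ∑ i ∈ s, v i t := by
  have hle : ∀ i ∈ s, v i =O[l] fun t => ∑ j ∈ s, v j t := by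
    intro i hi
    refine IsBigO.of_bound 1 ?_
    filter_upwards [(Filter.eventually_all_finset s).mpr hv] with t ht
    have h1 : v i t ≤ ∑ j ∈ s, v j t := Finset.single_le_sum (f := fun j => v j t) ht hi
    rw [one_mul, Real.norm_of_nonneg (ht i hi), Real.norm_of_nonneg ((ht i hi).trans h1)]
    exact h1
  have h := IsLittleO.sum fun i hi => (huv i hi).isLittleO.trans_isBigO (hle i hi)
  refine h.congr_left fun t => ?_
  simp [Finset.sum_sub_distrib]

/-! ### The coefficients -/

/-- The coefficient `b_i` of the high-SNR power of stream `i`, read off from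
`isEquivalent_power` with diversity orders `n - m + i + 1`; the factor `4 ^ _` compensates for the
`4 γ₀` in `approxPower`. -/
noncomputable def highSNRCoeff (n m : ℕ) (R : ℝ) (i : Fin m) : ℝ :=
  (Real.exp R - 1)
    / ((((n - m + i).factorial : ℝ) / (n - m).factorial) ^ (((n - m + i : ℕ) + 2 : ℝ)⁻¹)
      * ((Real.exp R - 1) / m) ^ (((n - m : ℕ) + 2 : ℝ) / ((n - m + i : ℕ) + 2)))
    * 4 ^ (((i : ℕ) : ℝ) / ((n : ℝ) - (m : ℝ) + ((i : ℕ) : ℝ) + 2))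

theorem highSNRCoeff_pos {n m : ℕ} {R : ℝ} (hR : 0 < R) (i : Fin m) : 0 < highSNRCoeff n m R i := by
  have hc : 0 < Real.exp R - 1 := by linarith [Real.add_one_lt_exp hR.ne']
  have hm : (0 : ℝ) < m := by exact_mod_cast i.pos
  have h1 : (0 : ℝ) < (n - m + i).factorial := by exact_mod_cast Nat.factorial_pos _
  have h2 : (0 : ℝ) < (n - m).factorial := by exact_mod_cast Nat.factorial_pos _
  unfold highSNRCoeff
  positivity

theorem approxPower_highSNRCoeff {n m : ℕ} (hmn : m ≤ n) {R : ℝ} (hR : 0 < R) (i : Fin m) {γ : ℝ}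
    (hγ : 0 < γ) :
    approxPower n (highSNRCoeff n m R) i γ
      = (Real.exp R - 1) / γ
        / ((((n - m + i).factorial : ℝ) / (n - m).factorial) ^ (((n - m + i : ℕ) + 2 : ℝ)⁻¹)
          * ((Real.exp R - 1) / γ / m)
            ^ (((n - m : ℕ) + 2 : ℝ) / ((n - m + i : ℕ) + 2))) := by
  have hc : 0 < Real.exp R - 1 := by linarith [Real.add_one_lt_exp hR.ne']
  have hm : (0 : ℝ) < m := by exact_mod_cast i.pos
  have h1 : (0 : ℝ) < (n - m + i).factorial := by exact_mod_cast Nat.factorial_pos _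
  have h2 : (0 : ℝ) < (n - m).factorial := by exact_mod_cast Nat.factorial_pos _
  have hexp : ((i : ℕ) : ℝ) / ((n : ℝ) - (m : ℝ) + ((i : ℕ) : ℝ) + 2)
      = 1 - ((n - m : ℕ) + 2 : ℝ) / ((n - m + i : ℕ) + 2) := by
    have h : (0 : ℝ) < (n - m + i : ℕ) + 2 := by positivity
    rw [eq_sub_iff_add_eq]
    push_cast [Nat.cast_sub hmn] at h ⊢
    rw [← add_div, div_eq_one_iff_eq h.ne']
    ring
  rw [approxPower, highSNRCoeff, hexp]
  set q : ℝ := ((n - m : ℕ) + 2 : ℝ) / ((n - m + i : ℕ) + 2)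
  set K : ℝ := (((n - m + i).factorial : ℝ) / (n - m).factorial) ^ (((n - m + i : ℕ) + 2 : ℝ)⁻¹)
    with hK
  have hKpos : 0 < K := by positivity
  rw [Real.mul_rpow (by norm_num) hγ.le, Real.rpow_sub hγ, Real.rpow_one,
    show (Real.exp R - 1) / γ / m = (Real.exp R - 1) / m / γ by ring,
    Real.div_rpow (by positivity) hγ.le]
  field_simp

end VBLAST

open VBLAST in
theorem theorem3 (n m : ℕ) (hm : 0 < m) (hmn : m ≤ n) (R : ℝ) (hR : 0 < R) :
    ∃ b : Fin m → ℝ, (∀ i, 0 < b i) ∧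
      ∀ (Ω : Type*) [MeasurableSpace Ω] (μ : Measure Ω) [IsProbabilityMeasure μ]
        (H : Ω → Matrix (Fin n) (Fin m) ℂ), IsIIDRayleigh H μ →
        (∀ γ₀ : ℝ, 0 < γ₀ → ∃ α : Fin m → ℝ, IsOptimalAllocation μ H R γ₀ α) ∧
        ∀ α : ℝ → Fin m → ℝ, (∀ γ₀ : ℝ, 0 < γ₀ → IsOptimalAllocation μ H R γ₀ (α γ₀)) →
          (∀ i : Fin m, 0 < (i : ℕ) → (fun γ₀ => α γ₀ i) ~[atTop] approxPower n b i) ∧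
          (∀ γ₀ : ℝ, 0 < γ₀ →
            α γ₀ ⟨0, hm⟩ = m - ∑ i ∈ Finset.univ.filter (fun i : Fin m => 0 < (i : ℕ)), α γ₀ i) ∧
          (fun γ₀ => m - α γ₀ ⟨0, hm⟩) ~[atTop]
            (fun γ₀ => ∑ i ∈ Finset.univ.filter (fun i : Fin m => 0 < (i : ℕ)), approxPower n b i γ₀) ∧
          Tendsto (fun γ₀ => α γ₀ ⟨0, hm⟩) atTop (𝓝 (m : ℝ)) := by
  have hc : 0 < Real.exp R - 1 := by linarith [Real.add_one_lt_exp hR.ne']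
  refine ⟨highSNRCoeff n m R, highSNRCoeff_pos hR, ?_⟩
  intro Ω _ μ _ H hH
  have hiff : ∀ γ : ℝ, 0 < γ → ∀ α : Fin m → ℝ, IsOptimalAllocation μ H R γ α ↔
      α ∈ allocations m ∧ IsMaxOn (fun α : Fin m → ℝ =>
        ∏ i : Fin m, reliability (n - m + i + 1) ((Real.exp R - 1) / γ) (α i)) (allocations m) α := by
    intro γ hγ α
    refine and_congr_right fun hα => forall₂_congr fun β hβ => ?_
    rw [Set.mem_ofPred_eq, Set.mem_ofPred_eq, outageProb_eq hmn hH hR hγ hα.1,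
      outageProb_eq hmn hH hR hγ hβ.1, sub_le_sub_iff_left]
  refine ⟨fun γ hγ => ?_, fun α hopt => ?_⟩
  · obtain ⟨α, hα⟩ := exists_isMaxOn_prod_reliability (fun i : Fin m => n - m + i)
      (div_pos hc hγ)
    exact ⟨α, (hiff γ hγ α).mpr hα⟩
  have hα : ∀ γ, 0 < γ → α γ ∈ allocations m := fun γ hγ => (hopt γ hγ).1
  have hmax := fun γ (hγ : 0 < γ) => ((hiff γ hγ (α γ)).mp (hopt γ hγ)).2
  have hpos : ∀ γ, 0 < γ → ∀ i, 0 < α γ i := fun γ hγ =>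
    pos_of_isMaxOn_prod_reliability (κ := fun i : Fin m => n - m + i) (div_pos hc hγ) (hmax γ hγ)
  have hst := fun γ (hγ : 0 < γ) => stationary_of_isMaxOn (κ := fun i : Fin m => n - m + i)
    (div_pos hc hγ) (hα γ hγ) (hmax γ hγ)
  have hleast : ∀ i : Fin m, i ≠ ⟨0, hm⟩ →
      (fun i : Fin m => n - m + (i : ℕ)) ⟨0, hm⟩ < (fun i : Fin m => n - m + (i : ℕ)) i := by
    intro i hi
    have : (i : ℕ) ≠ 0 := fun h => hi (Fin.ext h)
    simp only
    omega
  -- The asymptotics hold for the first stream too, where the exponent is `0`.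
  have hequiv : ∀ i : Fin m, (fun γ₀ => α γ₀ i) ~[atTop] approxPower n (highSNRCoeff n m R) i := by
    intro i
    refine (isEquivalent_power hm hc hα hpos hst hleast i).congr_right ?_
    filter_upwards [eventually_gt_atTop 0] with γ hγ
    exact (approxPower_highSNRCoeff hmn hR i hγ).symm
  have hsum : ∀ γ : ℝ, 0 < γ → α γ ⟨0, hm⟩
      = m - ∑ i ∈ Finset.univ.filter (fun i : Fin m => 0 < (i : ℕ)), α γ i := by
    intro γ hγ
    have herase : Finset.univ.filter (fun i : Fin m => 0 < (i : ℕ))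
        = Finset.univ.erase ⟨0, hm⟩ := by
      ext i
      simp [Fin.ext_iff, Nat.pos_iff_ne_zero]
    rw [herase, ← (hα γ hγ).2, ← Finset.add_sum_erase _ _ (Finset.mem_univ (⟨0, hm⟩ : Fin m))]
    ring
  refine ⟨fun i _ => hequiv i, hsum, ?_, tendsto_power_of_least hm hc hα hpos hst hleast⟩
  refine (isEquivalent_sum_of_nonneg _ (fun i _ => hequiv i) fun i _ => ?_).congr_left ?_
  · filter_upwards [eventually_gt_atTop 0] with γ hγ
    have := highSNRCoeff_pos (n := n) hR i
    unfold approxPower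
    positivity
  · filter_upwards [eventually_gt_atTop 0] with γ hγ
    rw [hsum γ hγ]
    ring
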